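/- Let $M$ be a smooth manifold of dimension $n\ge 2$ with (possibly empty) boundary $\partial M$, let $g$ be a smooth Riemannian metric on $M$, and let $f:M\to\mathbb{R}$ be a smooth function that is positive on $M\setminus\partial M$ and zero on $\partial M$. Denote by $\mathrm{Ric}$, $\nabla^2$ and $\Delta=\mathrm{tr}_g\nabla^2$ the Ricci tensor, the Hessian and the Laplace--Beltrami operator of $g$. On $M\setminus\partial M$ put $$\tilde g=\frac{g}{f^2},\qquad \psi=-(n-1)\log f,$$ and denote by $\mathrm{Ric}_{\tilde g}$ and $\widetilde\nabla^2$ the Ricci tensor and the Hessian of $\tilde g$. Then $\tilde g$ is a smooth Riemannian metric and $\psi$ is a smooth function on $M\setminus\partial M$, and on $M\setminus\partial M$ $$\mathrm{Ric}-\frac1f\nabla^2 f+\frac1f(\Delta f)\,g\;=\;\mathrm{Ric}_{\tilde g}+\widetilde\nabla^2\psi+\frac1{n-1}\,d\psi\otimes d\psi .$$ Consequently $(M,g,f)$ is substatic, i.e. $f\,\mathrm{Ric}-\nabla^2 f+(\Delta f)\,g\ge 0$ on $M$, if and only if $(M\setminus\partial M,\tilde g,\psi)$ satisfies the condition $\mathrm{CD}(0,1)$,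 i.e. $\mathrm{Ric}_{\tilde g}+\widetilde\nabla^2\psi+\frac1{n-1}\,d\psi\otimes d\psi\ge 0$ on $M\setminus\partial M$. -/

import Mathlib

open Set Manifold ContDiff

set_option maxSynthPendingDepth 3

noncomputable section

/-! ## Riemannian geometry in coordinates

`E` is the coordinate space (real, finite dimensional), `S ⊆ E` is the set along which derivatives
are taken (all of `E`, or a half-space when the manifold has boundary), and `G : E → E →L E →L ℝ`
is the coordinate expression `y ↦ (g_{ij}(y))` of a metric. -/

namespace Coord

variable {E : Type*} [NormedAddCommGroup E] [NormedSpace ℝ E]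

/-- The first Christoffel symbols
`Γ(v, w; u) = ½ (∂_v g(w, u) + ∂_w g(v, u) - ∂_u g(v, w))`, see `christoffelLow_apply`. -/
def christoffelLow (S : Set E) (G : E → E →L[ℝ] E →L[ℝ] ℝ) (y : E) :
    E →L[ℝ] E →L[ℝ] E →L[ℝ] ℝ :=
  (2⁻¹ : ℝ) • (fderivWithin ℝ G S y + (fderivWithin ℝ G S y).flip -
    (ContinuousLinearMap.flipₗᵢ ℝ E E ℝ).toContinuousLinearEquiv.toContinuousLinearMap ∘L
      (fderivWithin ℝ G S y).flip)

theorem christoffelLow_apply (S : Set E) (G : E → E →L[ℝ] E →L[ℝ] ℝ) (y v w u : E) :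
    christoffelLow S G y v w u =
      2⁻¹ * (fderivWithin ℝ G S y v w u + fderivWithin ℝ G S y w v u
        - fderivWithin ℝ G S y u v w) := rfl

/-- The inverse metric, as the musical isomorphism `E* → E`. -/
def sharp (G : E → E →L[ℝ] E →L[ℝ] ℝ) (y : E) : (E →L[ℝ] ℝ) →L[ℝ] E :=
  (G y).inverse

/-- The Christoffel symbols `Γ(v, w)` of the Levi-Civita connection, `Γ(v, w)ᵏ = Γᵏᵢⱼ vⁱ wʲ`:
for constant coordinate fields `v, w` one has `∇_v w = Γ(v, w)`. -/
def christoffel (S : Set E) (G : E → E →L[ℝ] E →L[ℝ] ℝ) (y : E) : E →L[ℝ] E →L[ℝ] E :=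
  (ContinuousLinearMap.compL ℝ E (E →L[ℝ] ℝ) E (sharp G y)) ∘L christoffelLow S G y

theorem christoffel_apply (S : Set E) (G : E → E →L[ℝ] E →L[ℝ] ℝ) (y v w : E) :
    christoffel S G y v w = sharp G y (christoffelLow S G y v w) := rfl

/-- For fixed `v, w`, the endomorphism `u ↦ R(u, v) w`, where
`R(u, v) w = ∇_u ∇_v w - ∇_v ∇_u w - ∇_{[u, v]} w`, see `curvature_apply`. -/
def curvature (S : Set E) (G : E → E →L[ℝ] E →L[ℝ] ℝ) (y v w : E) : E →L[ℝ] E :=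
  ((fderivWithin ℝ (christoffel S G) S y).flip v).flip w
    - (fderivWithin ℝ (christoffel S G) S y v).flip w
    + (christoffel S G y).flip (christoffel S G y v w)
    - (christoffel S G y v) ∘L ((christoffel S G y).flip w)

theorem curvature_apply (S : Set E) (G : E → E →L[ℝ] E →L[ℝ] ℝ) (y u v w : E) :
    curvature S G y v w u =
      fderivWithin ℝ (christoffel S G) S y u v w - fderivWithin ℝ (christoffel S G) S y v u w
        + christoffel S G y u (christoffel S G y v w)
        - christoffel S G y v (christoffel S G y u w) := rfl

/-- The Ricci tensor `Ric(v, w) = tr (u ↦ R(u, v) w)`. -/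
def ricci (S : Set E) (G : E → E →L[ℝ] E →L[ℝ] ℝ) (y v w : E) : ℝ :=
  LinearMap.trace ℝ E (curvature S G y v w : E →ₗ[ℝ] E)

/-- The Hessian `∇²φ(v, w) = ∂_v ∂_w φ - ∂_{Γ(v, w)} φ`. -/
def hessian (S : Set E) (G : E → E →L[ℝ] E →L[ℝ] ℝ) (φ : E → ℝ) (y : E) :
    E →L[ℝ] E →L[ℝ] ℝ :=
  fderivWithin ℝ (fderivWithin ℝ φ S) S y
    - (ContinuousLinearMap.compL ℝ E E ℝ (fderivWithin ℝ φ S y)) ∘L christoffel S G y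

theorem hessian_apply (S : Set E) (G : E → E →L[ℝ] E →L[ℝ] ℝ) (φ : E → ℝ) (y v w : E) :
    hessian S G φ y v w =
      fderivWithin ℝ (fderivWithin ℝ φ S) S y v w
        - fderivWithin ℝ φ S y (christoffel S G y v w) := rfl

/-- The Laplace-Beltrami operator `Δφ = tr_g ∇²φ`. -/
def laplacian (S : Set E) (G : E → E →L[ℝ] E →L[ℝ] ℝ) (φ : E → ℝ) (y : E) : ℝ :=
  LinearMap.trace ℝ E (sharp G y ∘L hessian S G φ y : E →ₗ[ℝ] E)

end Coord

/-! ## Tensors on a manifold, read in a chart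

`e` is a chart of `M`; vectors `v w : E` are the components of tangent vectors in that chart. A
tensor identity or inequality on `M` is its validity, at each point, in every smooth chart around
that point. -/

section Manifold

variable {E : Type*} [NormedAddCommGroup E] [NormedSpace ℝ E]
  {H : Type*} [TopologicalSpace H] (I : ModelWithCorners ℝ E H)
  {M : Type*} [TopologicalSpace M] [ChartedSpace H M]

/-- The coordinate expression of a (0,2)-tensor field `g` in the chart `e`: the value of `g` on the
coordinate vector fields of the chart. -/
def metricInChart (e : OpenPartialHomeomorph M H)
    (g : ∀ x : M, TangentSpace I x →L[ℝ] TangentSpace I x →L[ℝ] ℝ) (y : E) :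
    E →L[ℝ] E →L[ℝ] ℝ :=
  let L : E →L[ℝ] TangentSpace I ((e.extend I).symm y) :=
    mfderivWithin 𝓘(ℝ, E) I (e.extend I).symm (range I) y
  (L.precomp ℝ) ∘L (g ((e.extend I).symm y)) ∘L L

/-- The coordinate expression of a function in the chart `e`. -/
def funInChart (e : OpenPartialHomeomorph M H) (φ : M → ℝ) (y : E) : ℝ :=
  φ ((e.extend I).symm y)

/-- The components `g_x(v, w)` of the metric in the chart `e`. -/
def metricAt (e : OpenPartialHomeomorph M H)
    (g : ∀ x : M, TangentSpace I x →L[ℝ] TangentSpace I x →L[ℝ] ℝ) (x : M) (v w : E) : ℝ :=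
  metricInChart I e g (e.extend I x) v w

/-- The components `Ric_g(v, w)` at `x` of the Ricci tensor in the chart `e`. -/
def ricciAt (e : OpenPartialHomeomorph M H)
    (g : ∀ x : M, TangentSpace I x →L[ℝ] TangentSpace I x →L[ℝ] ℝ) (x : M) (v w : E) : ℝ :=
  Coord.ricci (range I) (metricInChart I e g) (e.extend I x) v w

/-- The components `∇²φ(v, w)` at `x` of the `g`-Hessian in the chart `e`. -/
def hessianAt (e : OpenPartialHomeomorph M H)
    (g : ∀ x : M, TangentSpace I x →L[ℝ] TangentSpace I x →L[ℝ] ℝ) (φ : M → ℝ) (x : M)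
    (v w : E) : ℝ :=
  Coord.hessian (range I) (metricInChart I e g) (funInChart I e φ) (e.extend I x) v w

/-- The `g`-Laplacian of `φ` at `x`, computed in the chart `e`. -/
def laplacianAt (e : OpenPartialHomeomorph M H)
    (g : ∀ x : M, TangentSpace I x →L[ℝ] TangentSpace I x →L[ℝ] ℝ) (φ : M → ℝ) (x : M) : ℝ :=
  Coord.laplacian (range I) (metricInChart I e g) (funInChart I e φ) (e.extend I x)

/-- The value `dφ(v)` at `x` of the differential in the chart `e`. -/
def differentialAt (e : OpenPartialHomeomorph M H) (φ : M → ℝ) (x : M) (v : E) : ℝ :=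
  fderivWithin ℝ (funInChart I e φ) (range I) (e.extend I x) v

/-- The tensor field `g` restricted to `s` is a smooth Riemannian metric. -/
structure IsRiemannianMetricOn [IsManifold I ∞ M]
    (g : ∀ x : M, TangentSpace I x →L[ℝ] TangentSpace I x →L[ℝ] ℝ) (s : Set M) : Prop where
  symm : ∀ x ∈ s, ∀ v w : TangentSpace I x, g x v w = g x w v
  pos : ∀ x ∈ s, ∀ v : TangentSpace I x, v ≠ 0 → 0 < g x v v
  contMDiffOn : ContMDiffOn I (I.prod 𝓘(ℝ, E →L[ℝ] E →L[ℝ] ℝ)) ∞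
    (fun x ↦ Bundle.TotalSpace.mk' (E →L[ℝ] E →L[ℝ] ℝ)
      (E := fun x : M ↦ TangentSpace I x →L[ℝ] TangentSpace I x →L[ℝ] ℝ) x (g x)) s

/-- The substatic inequality `f Ric - ∇²f + (Δf) g ≥ 0` on all of `M` (boundary included). -/
def IsSubstatic (g : ∀ x : M, TangentSpace I x →L[ℝ] TangentSpace I x →L[ℝ] ℝ) (f : M → ℝ) :
    Prop :=
  ∀ e ∈ IsManifold.maximalAtlas I ∞ M, ∀ x ∈ e.source, ∀ v : E,
    0 ≤ f x * ricciAt I e g x v v - hessianAt I e g f x v v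
      + laplacianAt I e g f x * metricAt I e g x v v

/-- The condition `CD(0,1)`, that is `Ric_g + ∇²ψ + (n-1)⁻¹ dψ ⊗ dψ ≥ 0` with `n = dim M`,
on the subset `s` of `M`. -/
def SatisfiesCD01On (g : ∀ x : M, TangentSpace I x →L[ℝ] TangentSpace I x →L[ℝ] ℝ)
    (ψ : M → ℝ) (s : Set M) : Prop :=
  ∀ e ∈ IsManifold.maximalAtlas I ∞ M, ∀ x ∈ e.source ∩ s, ∀ v : E,
    0 ≤ ricciAt I e g x v v + hessianAt I e g ψ x v v
      + ((Module.finrank ℝ E : ℝ) - 1)⁻¹ * (differentialAt I e ψ x v * differentialAt I e ψ x v)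

/-- The conformal metric `g / f²`. -/
def conformalMetric (g : ∀ x : M, TangentSpace I x →L[ℝ] TangentSpace I x →L[ℝ] ℝ) (f : M → ℝ) :
    ∀ x : M, TangentSpace I x →L[ℝ] TangentSpace I x →L[ℝ] ℝ :=
  fun x ↦ (f x ^ 2)⁻¹ • g x

end Manifold

end

/-! Put `u = -log f` and `n = dim M`. Then `g / f² = exp (2u) g` and `ψ = (n-1) u`, so the identity
is a computation with a conformal change of metric. The Christoffel symbols change by `A(v,w) =
du(v) w + du(w) v - g(v,w) ∇u`, which gives `Ric' = Ric - (n-2) (∇²u - du⊗du + |∇u|² g) - (Δu) g`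
(`ricci_exp_smul`) and `∇'²ψ = (n-1) (∇²u - 2 du⊗du + |∇u|² g)` (`hessian_exp_smul`). Adding `dψ⊗dψ
/ (n-1) = (n-1) du⊗du` leaves `Ric + ∇²u - du⊗du + (|∇u|² - Δu) g`. This is the left side, because
`∇²f = f (du⊗du - ∇²u)` and `Δf = f (|∇u|² - Δu)`.

In the interior the two inequalities therefore differ by the positive factor `f`. The substatic
inequality extends to boundary points because its tensor involves no division by `f`, is continuous
up to the boundary (`continuousOn_substaticTensor`), and the interior is dense
(`ModelWithCorners.dense_interior`). -/

namespace Coord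

variable {E : Type*} [NormedAddCommGroup E] [NormedSpace ℝ E]

/-- `G` is a smooth Riemannian metric in coordinates on the set `S`. -/
structure IsMetricOn (S : Set E) (G : E → E →L[ℝ] E →L[ℝ] ℝ) : Prop where
  uniqueDiffOn : UniqueDiffOn ℝ S
  subset_closure_interior : S ⊆ closure (interior S)
  contDiffOn : ContDiffOn ℝ ∞ G S
  symm : ∀ y ∈ S, ∀ v w, G y v w = G y w v
  pos : ∀ y ∈ S, ∀ v, v ≠ 0 → 0 < G y v v

/-! ### Locality in the set along which derivatives are taken -/

section Locality

variable {S T : Set E} {y : E}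

theorem christoffel_congr {G G' : E → E →L[ℝ] E →L[ℝ] ℝ} (hT : ∀ z ∈ T, T =ᶠ[nhds z] S)
    (hG : EqOn G' G T) : EqOn (christoffel S G') (christoffel T G) T := by
  intro z hz
  simp only [christoffel, christoffelLow, sharp, hG hz,
    ← fderivWithin_congr_set (hT z hz), fderivWithin_congr hG (hG hz)]

theorem ricci_congr {G G' : E → E →L[ℝ] E →L[ℝ] ℝ} (hT : ∀ z ∈ T, T =ᶠ[nhds z] S)
    (hG : EqOn G' G T) (hy : y ∈ T) (v w : E) : ricci S G' y v w = ricci T G y v w := by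
  have h := christoffel_congr hT hG
  simp only [ricci, curvature, h hy, ← fderivWithin_congr_set (hT y hy),
    fderivWithin_congr h (h hy)]

theorem hessian_congr {G G' : E → E →L[ℝ] E →L[ℝ] ℝ} {φ φ' : E → ℝ}
    (hT : ∀ z ∈ T, T =ᶠ[nhds z] S) (hG : EqOn G' G T) (hφ : EqOn φ' φ T) (hy : y ∈ T) :
    hessian S G' φ' y = hessian T G φ y := by
  have h : EqOn (fderivWithin ℝ φ' S) (fderivWithin ℝ φ T) T := fun z hz ↦ by
    rw [← fderivWithin_congr_set (hT z hz), fderivWithin_congr hφ (hφ hz)]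
  simp only [hessian, christoffel_congr hT hG hy, h hy]
  rw [← fderivWithin_congr_set (hT y hy), fderivWithin_congr h (h hy)]

theorem laplacian_congr {G G' : E → E →L[ℝ] E →L[ℝ] ℝ} {φ φ' : E → ℝ}
    (hT : ∀ z ∈ T, T =ᶠ[nhds z] S) (hG : EqOn G' G T) (hφ : EqOn φ' φ T) (hy : y ∈ T) :
    laplacian S G' φ' y = laplacian T G φ y := by
  simp only [laplacian, sharp, hessian_congr hT hG hφ hy, hG hy]

end Locality

/-! ### The Levi-Civita connection in coordinates -/

namespace IsMetricOn

variable {S : Set E} {G : E → E →L[ℝ] E →L[ℝ] ℝ} {y : E}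

theorem contDiffOn_fderivWithin (h : IsMetricOn S G) : ContDiffOn ℝ ∞ (fderivWithin ℝ G S) S :=
  h.contDiffOn.fderivWithin h.uniqueDiffOn le_rfl

theorem hasFDerivWithinAt (h : IsMetricOn S G) (hy : y ∈ S) :
    HasFDerivWithinAt G (fderivWithin ℝ G S y) S y :=
  (h.contDiffOn.differentiableOn (by simp) y hy).hasFDerivWithinAt

theorem hasFDerivWithinAt_apply (h : IsMetricOn S G) (hy : y ∈ S) (v w : E) :
    HasFDerivWithinAt (fun z ↦ G z v w) (((fderivWithin ℝ G S y).flip v).flip w) S y := by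
  have := ((h.hasFDerivWithinAt hy).clm_apply (hasFDerivWithinAt_const v y S)).clm_apply
    (hasFDerivWithinAt_const w y S)
  refine this.congr_fderiv ?_
  ext u; simp

theorem fderivWithin_symm (h : IsMetricOn S G) (hy : y ∈ S) (u v w : E) :
    fderivWithin ℝ G S y u v w = fderivWithin ℝ G S y u w v :=
  congr($((h.uniqueDiffOn y hy).eq (h.hasFDerivWithinAt_apply hy v w)
    ((h.hasFDerivWithinAt_apply hy w v).congr (fun z hz ↦ h.symm z hz v w) (h.symm y hy v w))) u)

theorem contDiffOn_christoffelLow (h : IsMetricOn S G) :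
    ContDiffOn ℝ ∞ (christoffelLow S G) S := by
  have hD := h.contDiffOn_fderivWithin
  have hF : ContDiffOn ℝ ∞ (fun y ↦ (fderivWithin ℝ G S y).flip) S :=
    (ContinuousLinearMap.flipₗᵢ ℝ E E (E →L[ℝ] ℝ)).contDiff.comp_contDiffOn hD
  exact ((hD.add hF).sub (contDiffOn_const.clm_comp hF)).const_smul _

theorem christoffel_symm (h : IsMetricOn S G) (hy : y ∈ S) (v w : E) :
    christoffel S G y v w = christoffel S G y w v := by
  rw [christoffel_apply, christoffel_apply]
  congr 1
  ext u
  rw [christoffelLow_apply, christoffelLow_apply, h.fderivWithin_symm hy u v w]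
  ring

variable [FiniteDimensional ℝ E]

theorem isInvertible (h : IsMetricOn S G) (hy : y ∈ S) : (G y).IsInvertible := by
  have inj : Function.Injective (G y) := by
    refine (injective_iff_map_eq_zero _).2 fun v hv ↦ ?_
    by_contra hne
    simpa [hv] using h.pos y hy v hne
  have hd : Module.finrank ℝ E = Module.finrank ℝ (E →L[ℝ] ℝ) := by
    rw [← (LinearMap.toContinuousLinearMap : (E →ₗ[ℝ] ℝ) ≃ₗ[ℝ] (E →L[ℝ] ℝ)).finrank_eq]
    exact (Subspace.dual_finrank_eq (K := ℝ) (V := E)).symm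
  exact ⟨(LinearEquiv.ofInjectiveOfFinrankEq (G y : E →ₗ[ℝ] E →L[ℝ] ℝ) inj hd
    ).toContinuousLinearEquiv, by ext; rfl⟩

theorem apply_sharp (h : IsMetricOn S G) (hy : y ∈ S) (l : E →L[ℝ] ℝ) :
    G y (sharp G y l) = l :=
  (h.isInvertible hy).self_apply_inverse l

theorem ext (h : IsMetricOn S G) (hy : y ∈ S) {v w : E} (hvw : ∀ u, G y v u = G y w u) : v = w :=
  (h.isInvertible hy).injective (ContinuousLinearMap.ext hvw)

theorem contDiffOn_sharp (h : IsMetricOn S G) : ContDiffOn ℝ ∞ (sharp G) S := fun y hy ↦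
  (h.isInvertible hy).contDiffAt_map_inverse.comp_contDiffWithinAt y (h.contDiffOn y hy)

theorem contDiffOn_christoffel (h : IsMetricOn S G) : ContDiffOn ℝ ∞ (christoffel S G) S :=
  ((ContinuousLinearMap.compL ℝ E (E →L[ℝ] ℝ) E).contDiff.comp_contDiffOn
    h.contDiffOn_sharp).clm_comp h.contDiffOn_christoffelLow

theorem contDiffOn_hessian (h : IsMetricOn S G) {φ : E → ℝ} (hφ : ContDiffOn ℝ ∞ φ S) :
    ContDiffOn ℝ ∞ (hessian S G φ) S := by
  have hD := hφ.fderivWithin (m := ∞) h.uniqueDiffOn le_rfl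
  exact (hD.fderivWithin (m := ∞) h.uniqueDiffOn le_rfl).sub
    (((ContinuousLinearMap.compL ℝ E E ℝ).contDiff.comp_contDiffOn hD).clm_comp
      h.contDiffOn_christoffel)

theorem continuousOn_laplacian (h : IsMetricOn S G) {φ : E → ℝ} (hφ : ContDiffOn ℝ ∞ φ S) :
    ContinuousOn (laplacian S G φ) S := by
  have hc := (h.contDiffOn_sharp.clm_comp (h.contDiffOn_hessian hφ)).continuousOn
  exact (LinearMap.continuous_of_finiteDimensional
    (LinearMap.trace ℝ E ∘ₗ ContinuousLinearMap.coeLM ℝ)).comp_continuousOn hc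

theorem continuousOn_ricci (h : IsMetricOn S G) (v w : E) :
    ContinuousOn (fun y ↦ ricci S G y v w) S := by
  have hΓ := h.contDiffOn_christoffel
  have hD := hΓ.fderivWithin (m := ∞) h.uniqueDiffOn le_rfl
  have hflip {X : E → E →L[ℝ] E →L[ℝ] E} (hX : ContDiffOn ℝ ∞ X S) :
      ContDiffOn ℝ ∞ (fun y ↦ (X y).flip) S :=
    (ContinuousLinearMap.flipₗᵢ ℝ E E E).contDiff.comp_contDiffOn hX
  have hF : ContDiffOn ℝ ∞ (fun y ↦ (fderivWithin ℝ (christoffel S G) S y).flip) S :=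
    (ContinuousLinearMap.flipₗᵢ ℝ E E (E →L[ℝ] E)).contDiff.comp_contDiffOn hD
  have hc : ContDiffOn ℝ ∞ (fun y ↦ curvature S G y v w) S :=
    (((hflip (hF.clm_apply contDiffOn_const)).clm_apply contDiffOn_const).sub
      ((hflip (hD.clm_apply contDiffOn_const)).clm_apply contDiffOn_const)).add
      ((hflip hΓ).clm_apply ((hΓ.clm_apply contDiffOn_const).clm_apply contDiffOn_const)) |>.sub
      ((hΓ.clm_apply contDiffOn_const).clm_comp ((hflip hΓ).clm_apply contDiffOn_const))
  exact (LinearMap.continuous_of_finiteDimensional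
    (LinearMap.trace ℝ E ∘ₗ ContinuousLinearMap.coeLM ℝ)).comp_continuousOn hc.continuousOn

theorem apply_christoffel (h : IsMetricOn S G) (hy : y ∈ S) (v w u : E) :
    G y (christoffel S G y v w) u = 2⁻¹ * (fderivWithin ℝ G S y v w u
      + fderivWithin ℝ G S y w v u - fderivWithin ℝ G S y u v w) := by
  rw [christoffel_apply, h.apply_sharp hy, christoffelLow_apply]

/-- Metric compatibility `∇g = 0`: in the sum of the two Koszul formulas all other terms cancel. -/
theorem fderivWithin_eq_christoffel (h : IsMetricOn S G) (hy : y ∈ S) (u v w : E) :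
    fderivWithin ℝ G S y u v w =
      G y (christoffel S G y u v) w + G y v (christoffel S G y u w) := by
  rw [h.symm y hy v, h.apply_christoffel hy, h.apply_christoffel hy, h.fderivWithin_symm hy u w v]
  ring

end IsMetricOn

end Coord

/-! ### Gradient, Hessian and conformal change -/

namespace Coord

variable {E : Type*} [NormedAddCommGroup E] [NormedSpace ℝ E]
  {S : Set E} {G : E → E →L[ℝ] E →L[ℝ] ℝ} {u : E → ℝ} {y : E}

/-- The gradient of `u`. -/
noncomputable def gradient (S : Set E) (G : E → E →L[ℝ] E →L[ℝ] ℝ) (u : E → ℝ) (y : E) : E :=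
  sharp G y (fderivWithin ℝ u S y)

namespace IsMetricOn

/-- At boundary points the second derivative is symmetric because `S` lies in the closure of its
interior. -/
theorem hessian_symm (h : IsMetricOn S G) (hu : ContDiffOn ℝ ∞ u S) (hy : y ∈ S) (v w : E) :
    hessian S G u y v w = hessian S G u y w v := by
  rw [hessian_apply, hessian_apply, h.christoffel_symm hy v w,
    (hu y hy).isSymmSndFDerivWithinAt (by simpa using WithTop.coe_le_coe.2 (le_top (a := (2 : ℕ∞))))
      h.uniqueDiffOn (h.subset_closure_interior hy) hy]

variable [FiniteDimensional ℝ E]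

theorem apply_gradient (h : IsMetricOn S G) (hy : y ∈ S) (v : E) :
    G y (gradient S G u y) v = fderivWithin ℝ u S y v := by
  rw [gradient, h.apply_sharp hy]

theorem contDiffOn_gradient (h : IsMetricOn S G) (hu : ContDiffOn ℝ ∞ u S) :
    ContDiffOn ℝ ∞ (gradient S G u) S :=
  h.contDiffOn_sharp.clm_apply (hu.fderivWithin h.uniqueDiffOn le_rfl)

/-- `∇_v ∇u = (∇²u(v, ·))♯`. -/
theorem hasFDerivWithinAt_gradient (h : IsMetricOn S G) (hu : ContDiffOn ℝ ∞ u S) (hy : y ∈ S) :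
    HasFDerivWithinAt (gradient S G u) (sharp G y ∘L hessian S G u y -
      (christoffel S G y).flip (gradient S G u y)) S y := by
  have hN := ((h.contDiffOn_gradient hu).differentiableOn (by simp) y hy).hasFDerivWithinAt
  have hα := ((hu.fderivWithin (m := ∞) h.uniqueDiffOn le_rfl).differentiableOn
    (by simp) y hy).hasFDerivWithinAt
  refine hN.congr_fderiv (ContinuousLinearMap.ext fun a ↦ h.ext hy fun w ↦ ?_)
  -- Differentiate `du = g(∇u, ·)`; metric compatibility turns the derivative of `g` into
  -- Christoffel terms.
  have h1 := ((h.hasFDerivWithinAt hy).clm_apply hN).congr (f₁ := fderivWithin ℝ u S)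
    (fun z hz ↦ (h.apply_sharp hz _).symm) (h.apply_sharp hy _).symm
  have h2 := congr($((h.uniqueDiffOn y hy).eq hα h1) a w)
  simp only [add_apply, ContinuousLinearMap.comp_apply,
    ContinuousLinearMap.flip_apply, h.fderivWithin_eq_christoffel hy, h.apply_gradient hy] at h2
  simp only [sub_apply, ContinuousLinearMap.comp_apply,
    ContinuousLinearMap.flip_apply, map_sub, h.apply_sharp hy, hessian_apply, h2]
  ring

end IsMetricOn

/-- The difference `Γ' - Γ` of the Christoffel symbols of `exp (2 u) • G` and `G`. -/
noncomputable def conformalDiff (S : Set E) (G : E → E →L[ℝ] E →L[ℝ] ℝ) (u : E → ℝ)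
    (y v w : E) : E :=
  fderivWithin ℝ u S y v • w + fderivWithin ℝ u S y w • v - G y v w • gradient S G u y

namespace IsMetricOn

theorem exp_smul (h : IsMetricOn S G) (hu : ContDiffOn ℝ ∞ u S) :
    IsMetricOn S (fun y ↦ Real.exp (2 * u y) • G y) where
  uniqueDiffOn := h.uniqueDiffOn
  subset_closure_interior := h.subset_closure_interior
  contDiffOn := (contDiffOn_const.mul hu).exp.smul h.contDiffOn
  symm y hy v w := by simp [h.symm y hy v w]
  pos y hy v hv := by simpa using mul_pos (Real.exp_pos _) (h.pos y hy v hv)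

theorem fderivWithin_exp_smul (h : IsMetricOn S G) (hu : ContDiffOn ℝ ∞ u S) (hy : y ∈ S)
    (a v w : E) :
    fderivWithin ℝ (fun y ↦ Real.exp (2 * u y) • G y) S y a v w = Real.exp (2 * u y) *
      (fderivWithin ℝ G S y a v w + 2 * fderivWithin ℝ u S y a * G y v w) := by
  have hd := (hu.differentiableOn (by simp) y hy).hasFDerivWithinAt
  have := ((hd.const_mul 2).exp.smul (h.hasFDerivWithinAt hy)).fderivWithin (h.uniqueDiffOn y hy)
  rw [show (fun y ↦ Real.exp (2 * u y) • G y) = (fun x ↦ Real.exp (2 * u x)) • G from rfl, this]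
  simp
  ring

variable [FiniteDimensional ℝ E]

/-- Pair both sides with the metric `exp (2u) g`: the Koszul formula gives the old symbols plus the
terms from differentiating the conformal factor. -/
theorem christoffel_exp_smul (h : IsMetricOn S G) (hu : ContDiffOn ℝ ∞ u S) (hy : y ∈ S)
    (v w : E) :
    christoffel S (fun y ↦ Real.exp (2 * u y) • G y) y v w =
      christoffel S G y v w + conformalDiff S G u y v w := by
  have h' := h.exp_smul hu
  refine h'.ext hy fun a ↦ ?_
  rw [h'.apply_christoffel hy]
  simp only [h.fderivWithin_exp_smul hu hy, conformalDiff, smul_apply,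
    map_add, map_sub, map_smul, add_apply, sub_apply,
    h.apply_christoffel hy, h.apply_gradient hy, smul_eq_mul]
  ring

/-- The partial derivatives of `du`, `g` and `∇u` are traded for Hessians and Christoffel symbols,
so that the latter cancel in the curvature. -/
theorem hasFDerivWithinAt_conformalDiff (h : IsMetricOn S G) (hu : ContDiffOn ℝ ∞ u S)
    (hy : y ∈ S) (v w : E) :
    ∃ D : E →L[ℝ] E, HasFDerivWithinAt (fun z ↦ conformalDiff S G u z v w) D S y ∧ ∀ a, D a =
      (hessian S G u y a v + fderivWithin ℝ u S y (christoffel S G y a v)) • w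
      + (hessian S G u y a w + fderivWithin ℝ u S y (christoffel S G y a w)) • v
      - (G y (christoffel S G y a v) w + G y v (christoffel S G y a w)) • gradient S G u y
      - G y v w • (sharp G y (hessian S G u y a) - christoffel S G y a (gradient S G u y)) := by
  have hα := ((hu.fderivWithin (m := ∞) h.uniqueDiffOn le_rfl).differentiableOn
    (by simp) y hy).hasFDerivWithinAt
  have hα' (v : E) := hα.clm_apply (hasFDerivWithinAt_const v y S)
  refine ⟨_, (((hα' v).smul_const w).add ((hα' w).smul_const v)).sub
    ((h.hasFDerivWithinAt_apply hy v w).smul (h.hasFDerivWithinAt_gradient hu hy)), fun a ↦ ?_⟩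
  simp only [sub_apply, add_apply,
    ContinuousLinearMap.smulRight_apply, ContinuousLinearMap.comp_apply,
    ContinuousLinearMap.flip_apply, smul_apply, zero_apply,
    map_zero, zero_add, h.fderivWithin_eq_christoffel hy, hessian_apply]
  simp
  module

/-- The curvature of a conformal metric. -/
theorem curvature_exp_smul (h : IsMetricOn S G) (hu : ContDiffOn ℝ ∞ u S) (hy : y ∈ S)
    (a v w : E) :
    curvature S (fun y ↦ Real.exp (2 * u y) • G y) y v w a = curvature S G y v w a
      + hessian S G u y a w • v - hessian S G u y v w • a
      - G y v w • sharp G y (hessian S G u y a) + G y a w • sharp G y (hessian S G u y v)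
      + (fderivWithin ℝ u S y v * fderivWithin ℝ u S y w) • a
      - (fderivWithin ℝ u S y a * fderivWithin ℝ u S y w) • v
      - fderivWithin ℝ u S y (gradient S G u y) • (G y v w • a - G y a w • v)
      + (fderivWithin ℝ u S y a * G y v w - fderivWithin ℝ u S y v * G y a w) •
        gradient S G u y := by
  have h' := h.exp_smul hu
  have key (a v w : E) :
      fderivWithin ℝ (christoffel S (fun y ↦ Real.exp (2 * u y) • G y)) S y a v w =
        fderivWithin ℝ (christoffel S G) S y a v w +
      ((hessian S G u y a v + fderivWithin ℝ u S y (christoffel S G y a v)) • w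
      + (hessian S G u y a w + fderivWithin ℝ u S y (christoffel S G y a w)) • v
      - (G y (christoffel S G y a v) w + G y v (christoffel S G y a w)) • gradient S G u y
      - G y v w • (sharp G y (hessian S G u y a) - christoffel S G y a (gradient S G u y))) := by
    have hc {G : E → E →L[ℝ] E →L[ℝ] ℝ} (h : IsMetricOn S G) :=
      ((h.contDiffOn_christoffel.differentiableOn (by simp) y hy).hasFDerivWithinAt.clm_apply
        (hasFDerivWithinAt_const v y S)).clm_apply (hasFDerivWithinAt_const w y S)
    obtain ⟨D, hD, hDa⟩ := h.hasFDerivWithinAt_conformalDiff hu hy v w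
    have := congr($((h.uniqueDiffOn y hy).eq (hc h')
      (((hc h).add hD).congr (fun z hz ↦ h.christoffel_exp_smul hu hz v w)
        (h.christoffel_exp_smul hu hy v w))) a)
    simpa [hDa] using this
  -- With `A` the difference of the connections, `R'(a,v)w - R(a,v)w` is `(∇_a A)(v,w) - (∇_v
  -- A)(a,w) + A(a,A(v,w)) - A(v,A(a,w))`; the remaining Christoffel terms cancel by symmetry.
  simp only [curvature_apply, key, h.christoffel_exp_smul hu hy]
  simp only [conformalDiff, map_add, map_sub, map_smul, h.christoffel_symm hy v a,
    h.hessian_symm hu hy v a, h.symm y hy v a, smul_eq_mul,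
    h.symm y hy _ (christoffel S G y _ _), h.symm y hy _ (gradient S G u y), h.apply_gradient hy]
  module

/-- The Ricci tensor of a conformal metric. -/
theorem ricci_exp_smul (h : IsMetricOn S G) (hu : ContDiffOn ℝ ∞ u S) (hy : y ∈ S) (v w : E) :
    ricci S (fun y ↦ Real.exp (2 * u y) • G y) y v w = ricci S G y v w
      - ((Module.finrank ℝ E : ℝ) - 2) * (hessian S G u y v w
        - fderivWithin ℝ u S y v * fderivWithin ℝ u S y w
        + fderivWithin ℝ u S y (gradient S G u y) * G y v w)
      - laplacian S G u y * G y v w := by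
  set α := fderivWithin ℝ u S y with hα
  set N := gradient S G u y with hN
  -- Apart from the old curvature, the endomorphism is a sum of rank-one maps, a multiple of the
  -- identity and the raised Hessian; their traces are evaluations, `n` and `Δu`.
  have : (curvature S (fun y ↦ Real.exp (2 * u y) • G y) y v w : E →ₗ[ℝ] E) =
      (curvature S G y v w : E →ₗ[ℝ] E)
      + (hessian S G u y w : E →ₗ[ℝ] ℝ).smulRight v
      + (α v * α w - hessian S G u y v w - α N * G y v w) • LinearMap.id
      - G y v w • (sharp G y ∘L hessian S G u y : E →ₗ[ℝ] E)
      + (G y w : E →ₗ[ℝ] ℝ).smulRight (sharp G y (hessian S G u y v) + α N • v - α v • N)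
      + (α : E →ₗ[ℝ] ℝ).smulRight (G y v w • N - α w • v) := by
    ext a
    simp only [ContinuousLinearMap.coe_coe, h.curvature_exp_smul hu hy, LinearMap.add_apply,
      LinearMap.sub_apply, LinearMap.smul_apply, LinearMap.smulRight_apply, LinearMap.id_apply,
      ContinuousLinearMap.comp_apply, h.symm y hy w a, h.hessian_symm hu hy w a, hα, ← hN]
    module
  rw [ricci, ricci, laplacian, this]
  simp only [map_add, map_sub, map_smul, LinearMap.trace_smulRight, LinearMap.trace_id,
    smul_eq_mul, ContinuousLinearMap.coe_coe, h.symm y hy w,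
    h.apply_sharp hy, hN, h.apply_gradient hy, h.hessian_symm hu hy w v, hα]
  ring

theorem hessian_exp_smul (h : IsMetricOn S G) (hu : ContDiffOn ℝ ∞ u S) (hy : y ∈ S)
    (φ : E → ℝ) (v w : E) :
    hessian S (fun y ↦ Real.exp (2 * u y) • G y) φ y v w = hessian S G φ y v w
      - fderivWithin ℝ φ S y (conformalDiff S G u y v w) := by
  rw [hessian_apply, hessian_apply, h.christoffel_exp_smul hu hy, map_add]
  ring

end IsMetricOn

end Coord

/-! ### The substitution `u = -log f` -/

namespace Coord

variable {E : Type*} [NormedAddCommGroup E] [NormedSpace ℝ E]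
  {S : Set E} {G : E → E →L[ℝ] E →L[ℝ] ℝ} {y : E}

theorem hessian_const_mul (hS : UniqueDiffOn ℝ S) (c : ℝ) {u : E → ℝ} (hu : ContDiffOn ℝ ∞ u S)
    (hy : y ∈ S) (v w : E) :
    hessian S G (fun z ↦ c * u z) y v w = c * hessian S G u y v w := by
  have h1 : EqOn (fderivWithin ℝ (fun z ↦ c * u z) S) (fun z ↦ c • fderivWithin ℝ u S z) S :=
    fun z hz ↦ fderivWithin_const_mul (hS z hz) (hu.differentiableOn (by simp) z hz) c
  have h2 : fderivWithin ℝ (fun z ↦ c • fderivWithin ℝ u S z) S y =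
      c • fderivWithin ℝ (fderivWithin ℝ u S) S y :=
    fderivWithin_const_smul (hS y hy)
      ((hu.fderivWithin (m := ∞) hS le_rfl).differentiableOn (by simp) y hy) c
  rw [hessian_apply, hessian_apply, fderivWithin_congr h1 (h1 hy), h1 hy, h2]
  simp
  ring

/-- The Hessian of `f`, computed from `log f`. -/
theorem hessian_eq_of_neg_log (hS : UniqueDiffOn ℝ S) {f : E → ℝ} (hf : ContDiffOn ℝ ∞ f S)
    (hpos : ∀ z ∈ S, 0 < f z) (hy : y ∈ S) (v w : E) :
    hessian S G f y v w = f y * (fderivWithin ℝ (fun z ↦ -Real.log (f z)) S y v *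
      fderivWithin ℝ (fun z ↦ -Real.log (f z)) S y w -
        hessian S G (fun z ↦ -Real.log (f z)) y v w) := by
  set u : E → ℝ := fun z ↦ -Real.log (f z) with hu_def
  have hu : ContDiffOn ℝ ∞ u S := (hf.log fun z hz ↦ (hpos z hz).ne').neg
  -- Since `f = exp (-u)`, `df = -f du`; this is differentiated once more.
  have h1 : EqOn (fderivWithin ℝ f S) (fun z ↦ -(f z • fderivWithin ℝ u S z)) S := fun z hz ↦ by
    have := ((hf.differentiableOn (by simp) z hz).hasFDerivWithinAt.log
      (hpos z hz).ne').neg.fderivWithin (hS z hz)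
    simp only [hu_def]
    rw [show (fun z ↦ -Real.log (f z)) = -fun z ↦ Real.log (f z) from rfl, this, smul_neg, neg_neg,
      smul_inv_smul₀ (hpos z hz).ne']
  have h2 := ((hf.differentiableOn (by simp) y hy).hasFDerivWithinAt.fun_smul
    ((hu.fderivWithin (m := ∞) hS le_rfl).differentiableOn
      (by simp) y hy).hasFDerivWithinAt).fun_neg.fderivWithin (hS y hy)
  rw [hessian_apply, hessian_apply, fderivWithin_congr h1 (h1 hy), h2, h1 hy]
  simp
  ring

variable [FiniteDimensional ℝ E]

/-- Raise an index in the formula for `∇²f` and take the trace: `du⊗du` becomes a rank-one map of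
trace `|∇u|²`. -/
theorem laplacian_eq_of_neg_log (h : IsMetricOn S G) {f : E → ℝ} (hf : ContDiffOn ℝ ∞ f S)
    (hpos : ∀ z ∈ S, 0 < f z) (hy : y ∈ S) :
    laplacian S G f y = f y * (fderivWithin ℝ (fun z ↦ -Real.log (f z)) S y
      (gradient S G (fun z ↦ -Real.log (f z)) y) -
        laplacian S G (fun z ↦ -Real.log (f z)) y) := by
  set u : E → ℝ := fun z ↦ -Real.log (f z) with hu_def
  have : (sharp G y ∘L hessian S G f y : E →ₗ[ℝ] E) =
      f y • ((fderivWithin ℝ u S y : E →ₗ[ℝ] ℝ).smulRight (gradient S G u y) -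
        (sharp G y ∘L hessian S G u y : E →ₗ[ℝ] E)) := by
    have h1 (v : E) : hessian S G f y v =
        f y • (fderivWithin ℝ u S y v • fderivWithin ℝ u S y - hessian S G u y v) := by
      ext w
      simp [hessian_eq_of_neg_log h.uniqueDiffOn hf hpos hy, ← hu_def]
    ext v
    simp [h1, gradient]
  rw [laplacian, this, map_smul, map_sub, LinearMap.trace_smulRight, ← laplacian]
  rfl

/-- The substatic tensor of `(G, f)` is the Bakry-Émery tensor of `G / f²` and
`-(n - 1) log f`. -/
theorem ricci_sub_hessian_add_laplacian_eq (hn : 2 ≤ Module.finrank ℝ E) (h : IsMetricOn S G)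
    {f : E → ℝ} (hf : ContDiffOn ℝ ∞ f S) (hpos : ∀ z ∈ S, 0 < f z) (hy : y ∈ S) (v w : E) :
    ricci S G y v w - (f y)⁻¹ * hessian S G f y v w + (f y)⁻¹ * laplacian S G f y * G y v w =
      ricci S (fun z ↦ (f z ^ 2)⁻¹ • G z) y v w
      + hessian S (fun z ↦ (f z ^ 2)⁻¹ • G z)
          (fun z ↦ -((Module.finrank ℝ E : ℝ) - 1) * Real.log (f z)) y v w
      + ((Module.finrank ℝ E : ℝ) - 1)⁻¹ *
        (fderivWithin ℝ (fun z ↦ -((Module.finrank ℝ E : ℝ) - 1) * Real.log (f z)) S y v *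
          fderivWithin ℝ (fun z ↦ -((Module.finrank ℝ E : ℝ) - 1) * Real.log (f z)) S y w) := by
  have hn' : (Module.finrank ℝ E : ℝ) - 1 ≠ 0 := by
    have : (2 : ℝ) ≤ Module.finrank ℝ E := by exact_mod_cast hn
    linarith
  rw [hessian_eq_of_neg_log h.uniqueDiffOn hf hpos hy, laplacian_eq_of_neg_log h hf hpos hy]
  have hu : ContDiffOn ℝ ∞ (fun z ↦ -Real.log (f z)) S :=
    (hf.log fun z hz ↦ (hpos z hz).ne').neg
  have hψ : (fun z ↦ -((Module.finrank ℝ E : ℝ) - 1) * Real.log (f z)) =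
      fun z ↦ ((Module.finrank ℝ E : ℝ) - 1) * -Real.log (f z) := by ext; ring
  have hG : EqOn (fun z ↦ (f z ^ 2)⁻¹ • G z) (fun z ↦ Real.exp (2 * -Real.log (f z)) • G z) S := by
    intro z hz
    simp only
    rw [two_mul, Real.exp_add, Real.exp_neg, Real.exp_log (hpos z hz), sq, mul_inv]
  rw [ricci_congr (fun _ _ ↦ .rfl) hG hy, hessian_congr (fun _ _ ↦ .rfl) hG (fun _ _ ↦ rfl) hy, hψ,
    hessian_const_mul h.uniqueDiffOn _ hu hy,
    fderivWithin_const_mul (h.uniqueDiffOn y hy) (hu.differentiableOn (by simp) y hy),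
    h.ricci_exp_smul hu hy, h.hessian_exp_smul hu hy]
  -- Coefficients on the right: `-(n-2) + (n-1) = 1` for `∇²u` and for `|∇u|² g`, and `(n-2) -
  -- 2(n-1) + (n-1) = -1` for `du⊗du`.
  simp only [conformalDiff, map_add, map_sub, map_smul, smul_eq_mul, smul_apply]
  have hfy := (hpos y hy).ne'
  field_simp
  ring

end Coord

theorem Coord.IsMetricOn.inter {E : Type*} [NormedAddCommGroup E] [NormedSpace ℝ E] {S O : Set E}
    {G : E → E →L[ℝ] E →L[ℝ] ℝ} (h : Coord.IsMetricOn S G) (hO : IsOpen O) :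
    Coord.IsMetricOn (S ∩ O) G where
  uniqueDiffOn := h.uniqueDiffOn.inter hO
  subset_closure_interior := by
    rw [interior_inter, hO.interior_eq, inter_comm, inter_comm _ O]
    exact (inter_subset_inter_right O h.subset_closure_interior).trans hO.inter_closure
  contDiffOn := h.contDiffOn.mono inter_subset_left
  symm y hy := h.symm y hy.1
  pos y hy := h.pos y hy.1

/-! ### From the manifold to charts -/

section Chart

variable {E : Type*} [NormedAddCommGroup E] [NormedSpace ℝ E]
  {H : Type*} [TopologicalSpace H] {I : ModelWithCorners ℝ E H}
  {M : Type*} [TopologicalSpace M] {e : OpenPartialHomeomorph M H}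

namespace OpenPartialHomeomorph

theorem uniqueDiffOn_extend_target : UniqueDiffOn ℝ (e.extend I).target := by
  rw [e.extend_target]
  exact I.uniqueDiffOn_preimage e.open_target

theorem extend_target_subset_closure_interior :
    (e.extend I).target ⊆ closure (interior (e.extend I).target) := by
  have hO : IsOpen (I.symm ⁻¹' e.target) := e.open_target.preimage I.continuous_symm
  rw [e.extend_target, interior_inter, hO.interior_eq]
  exact (inter_subset_inter_right _ I.range_subset_closure_interior).trans hO.inter_closure

theorem extend_target_eventuallyEq_range {y : E} (hy : y ∈ (e.extend I).target) :
    (e.extend I).target =ᶠ[nhds y] range I := by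
  rw [← (e.extend I).right_inv hy]
  exact e.extend_target_eventuallyEq (by simpa using (e.extend I).map_target hy)

variable [ChartedSpace H M]

theorem contMDiffOn_extend_symm_target [IsManifold I ∞ M] (he : e ∈ IsManifold.maximalAtlas I ∞ M) :
    ContMDiffOn 𝓘(ℝ, E) I ∞ (e.extend I).symm (e.extend I).target := by
  rw [e.extend_target']
  exact contMDiffOn_extend_symm he

/-- The chain rule for `e ∘ e⁻¹ = id` provides a left inverse. -/
theorem mfderivWithin_extend_symm_injective [IsManifold I ∞ M]
    (he : e ∈ IsManifold.maximalAtlas I ∞ M)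
    {y : E} (hy : y ∈ (e.extend I).target) :
    Function.Injective (mfderivWithin 𝓘(ℝ, E) I (e.extend I).symm (range I) y) := by
  have hx : (e.extend I).symm y ∈ e.source := by simpa using (e.extend I).map_target hy
  have hU : UniqueMDiffWithinAt 𝓘(ℝ, E) (e.extend I).target y :=
    (uniqueDiffOn_extend_target y hy).uniqueMDiffWithinAt
  have h1 := mfderivWithin_comp (u := univ) y
    ((contMDiffAt_extend he hx).mdifferentiableAt (by simp)).mdifferentiableWithinAt
    ((contMDiffOn_extend_symm_target he).mdifferentiableOn (by simp) y hy)
    (subset_univ _) hU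
  have h2 : mfderivWithin 𝓘(ℝ, E) 𝓘(ℝ, E) (e.extend I ∘ (e.extend I).symm)
      (e.extend I).target y = ContinuousLinearMap.id ℝ _ := by
    rw [← mfderivWithin_id hU]
    exact mfderivWithin_congr (fun z hz ↦ (e.extend I).right_inv hz) ((e.extend I).right_inv hy)
  rw [← mfderivWithin_congr_set (extend_target_eventuallyEq_range hy)]
  rw [h2] at h1
  exact Function.LeftInverse.injective (g := mfderivWithin I 𝓘(ℝ, E) (e.extend I) univ _)
    fun v ↦ congr($h1.symm v)

/-- The coordinate fields are the tangent map of the inverse chart applied to constant fields. -/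
theorem contMDiffOn_mfderivWithin_extend_symm [IsManifold I ∞ M]
    (he : e ∈ IsManifold.maximalAtlas I ∞ M) (v : E) :
    ContMDiffOn 𝓘(ℝ, E) I.tangent ∞ (fun y ↦ (⟨(e.extend I).symm y,
      mfderivWithin 𝓘(ℝ, E) I (e.extend I).symm (range I) y v⟩ : TangentBundle I M))
      (e.extend I).target := by
  have h1 := (contMDiffOn_extend_symm_target he).contMDiffOn_tangentMapWithin (m := ∞) le_rfl
    uniqueDiffOn_extend_target.uniqueMDiffOn
  have h2 : ContMDiff 𝓘(ℝ, E) 𝓘(ℝ, E).tangent ∞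
      (fun y ↦ (⟨y, v⟩ : TangentBundle 𝓘(ℝ, E) E)) :=
    contMDiff_vectorSpace_iff_contDiff.2 contDiff_const
  refine (h1.comp h2.contMDiffOn (fun y hy ↦ hy)).congr fun y hy ↦ ?_
  simp only [Function.comp_apply, tangentMapWithin,
    mfderivWithin_congr_set (extend_target_eventuallyEq_range hy)]

end OpenPartialHomeomorph

open OpenPartialHomeomorph

variable [ChartedSpace H M] [IsManifold I ∞ M]

theorem contDiffOn_funInChart {f : M → ℝ} (hf : ContMDiff I 𝓘(ℝ, ℝ) ∞ f)
    (he : e ∈ IsManifold.maximalAtlas I ∞ M) :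
    ContDiffOn ℝ ∞ (funInChart I e f) (e.extend I).target :=
  (hf.comp_contMDiffOn (contMDiffOn_extend_symm_target he)).contDiffOn

theorem isMetricOn_metricInChart [FiniteDimensional ℝ E]
    (g : Bundle.ContMDiffRiemannianMetric I ∞ E (fun x : M ↦ TangentSpace I x))
    (he : e ∈ IsManifold.maximalAtlas I ∞ M) :
    Coord.IsMetricOn (e.extend I).target (metricInChart I e g.inner) where
  uniqueDiffOn := uniqueDiffOn_extend_target
  subset_closure_interior := extend_target_subset_closure_interior
  contDiffOn := by
    refine contDiffOn_clm_apply.2 fun v ↦ contDiffOn_clm_apply.2 fun w ↦ ?_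
    have : ContMDiffOn 𝓘(ℝ, E) (I.prod 𝓘(ℝ, ℝ)) ∞
        (fun y ↦ Bundle.TotalSpace.mk' ℝ (E := Bundle.Trivial M ℝ) ((e.extend I).symm y)
          (metricInChart I e g.inner y v w)) (e.extend I).target :=
      ContMDiffOn.clm_bundle_apply₂ (F₁ := E) (F₂ := E)
        (g.contMDiff.comp_contMDiffOn (contMDiffOn_extend_symm_target he))
        (contMDiffOn_mfderivWithin_extend_symm he v) (contMDiffOn_mfderivWithin_extend_symm he w)
    intro y hy
    have := this y hy
    rw [Bundle.contMDiffWithinAt_totalSpace] at this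
    exact this.2.contDiffWithinAt
  symm y _ v w := g.symm _ _ _
  pos y hy v hv := g.pos _ _ fun h0 ↦ hv <| mfderivWithin_extend_symm_injective he hy <|
    h0.trans (map_zero _).symm

end Chart

/-- The target of a chart lies in the closure of its interior, so interior points of the target
accumulate at the image of `x`. -/
theorem ModelWithCorners.dense_interior {E : Type*} [NormedAddCommGroup E] [NormedSpace ℝ E]
    {H : Type*} [TopologicalSpace H] (I : ModelWithCorners ℝ E H)
    (M : Type*) [TopologicalSpace M] [ChartedSpace H M] [IsManifold I ∞ M] :
    Dense (I.interior M) := by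
  intro x
  refine mem_closure_iff.2 fun U hU hxU ↦ ?_
  set φ := (chartAt H x).extend I
  have hx : x ∈ (chartAt H x).source := mem_chart_source H x
  have hy : φ x ∈ φ.target := φ.map_source (by simp [φ])
  have hV : φ.symm ⁻¹' U ∈ nhds (φ x) :=
    OpenPartialHomeomorph.extend_preimage_mem_nhds _ hx (hU.mem_nhds hxU)
  obtain ⟨z, hzU, hz⟩ := mem_closure_iff_nhds.1
    (OpenPartialHomeomorph.extend_target_subset_closure_interior hy) _ hV
  have hzt : z ∈ φ.target := interior_subset hz
  -- Being an interior point may be tested in the chart at `x`, though the preferred chart at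
  -- `φ.symm z` can be another one.
  refine ⟨φ.symm z, hzU, (I.isInteriorPoint_iff_of_mem_atlas (n := ∞) (by simp)
    (chart_mem_atlas H x) (by simpa [φ] using φ.map_target hzt)).2 ?_⟩
  change φ (φ.symm z) ∈ interior φ.target
  rwa [φ.right_inv hzt]

open OpenPartialHomeomorph

/-! ### The identity and the continuity on the manifold -/

section Conformal

variable {E : Type*} [NormedAddCommGroup E] [NormedSpace ℝ E]
  {H : Type*} [TopologicalSpace H] {I : ModelWithCorners ℝ E H}
  {M : Type*} [TopologicalSpace M] [ChartedSpace H M] [IsManifold I ∞ M]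
  (g : Bundle.ContMDiffRiemannianMetric I ∞ E (fun x : M ↦ TangentSpace I x))
  {f : M → ℝ}

theorem isRiemannianMetricOn_conformalMetric (hf : ContMDiff I 𝓘(ℝ, ℝ) ∞ f) {s : Set M}
    (hpos : ∀ x ∈ s, 0 < f x) :
    IsRiemannianMetricOn I (conformalMetric I g.inner f) s where
  symm x _ v w := congrArg ((f x ^ 2)⁻¹ * ·) (g.symm x v w)
  pos x hx v hv := mul_pos (inv_pos.2 (pow_pos (hpos x hx) 2)) (g.pos x v hv)
  contMDiffOn := by
    have h : ContMDiffOn I 𝓘(ℝ, ℝ) ∞ (fun x ↦ (f x ^ 2)⁻¹) s :=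
      (hf.pow 2).contMDiffOn.inv₀ fun x hx ↦ (pow_pos (hpos x hx) 2).ne'
    exact h.smul_section g.contMDiff.contMDiffOn

variable [FiniteDimensional ℝ E]

theorem ricciAt_sub_hessianAt_add_laplacianAt_eq (hf : ContMDiff I 𝓘(ℝ, ℝ) ∞ f)
    {e : OpenPartialHomeomorph M H} (he : e ∈ IsManifold.maximalAtlas I ∞ M)
    (hn : 2 ≤ Module.finrank ℝ E) {x : M}
    (hx : x ∈ e.source) (hpos : 0 < f x) (v w : E) :
    ricciAt I e g.inner x v w - (f x)⁻¹ * hessianAt I e g.inner f x v w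
        + (f x)⁻¹ * laplacianAt I e g.inner f x * metricAt I e g.inner x v w
      = ricciAt I e (conformalMetric I g.inner f) x v w
        + hessianAt I e (conformalMetric I g.inner f)
          (fun x ↦ -((Module.finrank ℝ E : ℝ) - 1) * Real.log (f x)) x v w
        + ((Module.finrank ℝ E : ℝ) - 1)⁻¹
          * (differentialAt I e (fun x ↦ -((Module.finrank ℝ E : ℝ) - 1) * Real.log (f x)) x v *
            differentialAt I e (fun x ↦ -((Module.finrank ℝ E : ℝ) - 1) * Real.log (f x)) x w) := by
  have hF := contDiffOn_funInChart hf he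
  -- The coordinate identity needs `f > 0` on a whole set, so the chart target is cut down to the
  -- relatively open part where this holds.
  obtain ⟨O, hO, hOF⟩ := continuousOn_iff'.1 hF.continuousOn (Ioi 0) isOpen_Ioi
  have hG := (isMetricOn_metricInChart g he).inter hO
  set F := funInChart I e f
  set T := (e.extend I).target ∩ O
  have hFx : F (e.extend I x) = f x := congrArg f (e.extend_left_inv hx)
  have hxt : e.extend I x ∈ (e.extend I).target := (e.extend I).map_source (by simpa using hx)
  have hxT : e.extend I x ∈ T := by
    refine ⟨hxt, (hOF.le ⟨?_, hxt⟩).1⟩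
    exact hpos.trans_eq hFx.symm
  have hFpos : ∀ z ∈ T, 0 < F z := fun z hz ↦ (hOF.ge ⟨hz.2, hz.1⟩).1
  have hT : ∀ z ∈ T, T =ᶠ[nhds z] range I := fun z hz ↦
    (Filter.EventuallyEq.trans (Filter.mem_of_superset (hO.mem_nhds hz.2)
      fun a ha ↦ propext ⟨And.left, fun h ↦ ⟨h, ha⟩⟩)
      (extend_target_eventuallyEq_range hz.1))
  have key := Coord.ricci_sub_hessian_add_laplacian_eq hn hG (hF.mono inter_subset_left) hFpos hxT
    v w
  -- At its points `T` has the same germ as `range I`, along which the tensors on the manifold are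
  -- differentiated.
  rw [← Coord.ricci_congr hT (fun _ _ ↦ rfl) hxT,
    ← Coord.hessian_congr hT (fun _ _ ↦ rfl) (fun _ _ ↦ rfl) hxT,
    ← Coord.laplacian_congr hT (fun _ _ ↦ rfl) (fun _ _ ↦ rfl) hxT,
    ← Coord.ricci_congr hT (fun _ _ ↦ rfl) hxT,
    ← Coord.hessian_congr hT (fun _ _ ↦ rfl) (fun _ _ ↦ rfl) hxT,
    fderivWithin_congr_set (hT _ hxT), hFx] at key
  have hg' : metricInChart I e (conformalMetric I g.inner f) =
      fun z ↦ (F z ^ 2)⁻¹ • metricInChart I e g.inner z := by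
    ext z v w
    rfl
  rw [ricciAt, ricciAt, hessianAt, hessianAt, laplacianAt, metricAt, differentialAt,
    differentialAt, hg']
  exact key

theorem continuousOn_substaticTensor (hf : ContMDiff I 𝓘(ℝ, ℝ) ∞ f)
    {e : OpenPartialHomeomorph M H} (he : e ∈ IsManifold.maximalAtlas I ∞ M) (v w : E) :
    ContinuousOn (fun x ↦ f x * ricciAt I e g.inner x v w - hessianAt I e g.inner f x v w
      + laplacianAt I e g.inner f x * metricAt I e g.inner x v w) e.source := by
  have hF := contDiffOn_funInChart hf he
  have hG := isMetricOn_metricInChart g he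
  have hT : ∀ z ∈ (e.extend I).target, (e.extend I).target =ᶠ[nhds z] range I :=
    fun z hz ↦ extend_target_eventuallyEq_range hz
  have hm : MapsTo (e.extend I) e.source (e.extend I).target := fun x hx ↦
    (e.extend I).map_source (by simpa using hx)
  have he' : ContinuousOn (e.extend I) e.source := by simpa using e.continuousOn_extend (I := I)
  have hr := (hG.continuousOn_ricci v w).comp he' hm
  have hh := (((hG.contDiffOn_hessian hF).continuousOn.clm_apply (continuousOn_const (c := v))).clm_apply
    (continuousOn_const (c := w))).comp he' hm
  have hl := (hG.continuousOn_laplacian hF).comp he' hm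
  have hg := ((hG.contDiffOn.continuousOn.clm_apply (continuousOn_const (c := v))).clm_apply
    (continuousOn_const (c := w))).comp he' hm
  refine (((hf.continuous.continuousOn.mul hr).sub hh).add (hl.mul hg)).congr fun x hx ↦ ?_
  rw [ricciAt, hessianAt, laplacianAt, Coord.ricci_congr hT (fun _ _ ↦ rfl) (hm hx),
    Coord.hessian_congr hT (fun _ _ ↦ rfl) (fun _ _ ↦ rfl) (hm hx),
    Coord.laplacian_congr hT (fun _ _ ↦ rfl) (fun _ _ ↦ rfl) (hm hx)]
  rfl

end Conformal

theorem mainTheorem12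
    {E : Type*} [NormedAddCommGroup E] [NormedSpace ℝ E] [FiniteDimensional ℝ E]
    (hn : 2 ≤ Module.finrank ℝ E)
    {H : Type*} [TopologicalSpace H] (I : ModelWithCorners ℝ E H)
    {M : Type*} [TopologicalSpace M] [ChartedSpace H M] [IsManifold I ∞ M]
    (g : Bundle.ContMDiffRiemannianMetric I ∞ E (fun x : M ↦ TangentSpace I x))
    (f : M → ℝ) (hf : ContMDiff I 𝓘(ℝ, ℝ) ∞ f)
    (hpos : ∀ x ∈ I.interior M, 0 < f x) (hzero : ∀ x ∈ I.boundary M, f x = 0)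
    (g' : ∀ x : M, TangentSpace I x →L[ℝ] TangentSpace I x →L[ℝ] ℝ)
    (hg' : g' = conformalMetric I g.inner f)
    (ψ : M → ℝ) (hψ : ψ = fun x ↦ -((Module.finrank ℝ E : ℝ) - 1) * Real.log (f x)) :
    (IsRiemannianMetricOn I g' (I.interior M) ∧ ContMDiffOn I 𝓘(ℝ, ℝ) ∞ ψ (I.interior M)) ∧
    (∀ e ∈ IsManifold.maximalAtlas I ∞ M, ∀ x ∈ e.source ∩ I.interior M, ∀ v w : E,
      ricciAt I e g.inner x v w - (f x)⁻¹ * hessianAt I e g.inner f x v w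
          + (f x)⁻¹ * laplacianAt I e g.inner f x * metricAt I e g.inner x v w
        = ricciAt I e g' x v w + hessianAt I e g' ψ x v w
          + ((Module.finrank ℝ E : ℝ) - 1)⁻¹
            * (differentialAt I e ψ x v * differentialAt I e ψ x w)) ∧
    (IsSubstatic I g.inner f ↔ SatisfiesCD01On I g' ψ (I.interior M)) := by
  subst hg' hψ
  refine ⟨⟨isRiemannianMetricOn_conformalMetric g hf hpos, ?_⟩, fun e he x hx v w ↦
    ricciAt_sub_hessianAt_add_laplacianAt_eq g hf he hn hx.1 (hpos x hx.2) v w, ?_⟩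
  · have hlog : ContMDiffOn I 𝓘(ℝ, ℝ) ∞ (fun x ↦ Real.log (f x)) (I.interior M) := fun x hx ↦
      (Real.contDiffAt_log.2 (hpos x hx).ne').contMDiffAt.comp_contMDiffWithinAt x
        hf.contMDiffAt.contMDiffWithinAt
    exact contMDiffOn_const.mul hlog
  have key : ∀ e ∈ IsManifold.maximalAtlas I ∞ M, ∀ x ∈ e.source ∩ I.interior M, ∀ v : E,
      f x * ricciAt I e g.inner x v v - hessianAt I e g.inner f x v v
        + laplacianAt I e g.inner f x * metricAt I e g.inner x v v = f x *
      (ricciAt I e (conformalMetric I g.inner f) x v v + hessianAt I e (conformalMetric I g.inner f)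
          (fun x ↦ -((Module.finrank ℝ E : ℝ) - 1) * Real.log (f x)) x v v
        + ((Module.finrank ℝ E : ℝ) - 1)⁻¹
          * (differentialAt I e (fun x ↦ -((Module.finrank ℝ E : ℝ) - 1) * Real.log (f x)) x v *
            differentialAt I e (fun x ↦ -((Module.finrank ℝ E : ℝ) - 1) * Real.log (f x)) x v)) := by
    intro e he x hx v
    rw [← ricciAt_sub_hessianAt_add_laplacianAt_eq g hf he hn hx.1 (hpos x hx.2) v v]
    have := (hpos x hx.2).ne'
    field_simp
  constructor
  · intro h e he x hx v
    have := h e he x hx.1 v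
    rw [key e he x hx v] at this
    exact nonneg_of_mul_nonneg_right this (hpos x hx.2)
  · intro h e he x hx v
    -- The tensor at any `x`, boundary points included, is a limit of its values at interior points
    -- of the same chart, where `key` makes it nonnegative.
    have hne : (nhdsWithin x (I.interior M)).NeBot :=
      mem_closure_iff_nhdsWithin_neBot.1 (I.dense_interior M x)
    have hc := ((continuousOn_substaticTensor g hf he v v).continuousAt
      (e.open_source.mem_nhds hx)).continuousWithinAt (s := I.interior M)
    refine ge_of_tendsto hc.tendsto ?_
    filter_upwards [self_mem_nhdsWithin, mem_nhdsWithin_of_mem_nhds (e.open_source.mem_nhds hx)]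
      with z hz hze
    rw [key e he z ⟨hze, hz⟩ v]
    exact mul_nonneg (hpos z hz).le (h e he z ⟨hze, hz⟩ v)
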